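/- Let $a<b$ be odd positive integers and $\mathcal{A}=\{a,b\}$. Every finite word $u$ over $\mathcal{A}$ factors uniquely as $u=a_1^{p_1}\cdots a_n^{p_n}$ with $a_i\in\mathcal{A}$, $a_{i+1}\ne a_i$ and $p_i\ge 1$ (with $n=0$ for the empty word $\varepsilon$). Call $u$ *derivable* if $p_1,p_n\in\{1,\dots,b\}$ and $p_i\in\mathcal{A}$ for $1<i<n$, and then put $D_f(u)=\mathrm{cut}(p_1)\,p_2\cdots p_{n-1}\,\mathrm{cut}(p_n)$, a word over $\mathcal{A}$, where $\mathrm{cut}(p)=\varepsilon$ if $p\le a$ and $\mathrm{cut}(p)=b$ if $a<p\le b$, with the conventions $D_f(\varepsilon)=\varepsilon$ and $D_f(a_1^{p_1})=\mathrm{cut}(p_1)$. Let $\mathcal{C}_f^\infty$ be the set of *f-smooth* words, i.e. of the finite words $u$ such that $u, D_f(u), D_f^2(u),\dots$ are all defined and derivable, and let $p_{\mathcal{C}_f^\infty}(n)$ be the number of f-smooth words of length $n$. Let $\lambda=\frac{1+\sqrt{2b-1}}{2}$ if $a=1$, and otherwise let $\lambda$ be the dominant root of $X^3-\frac{a+b}{2}X^2+\frac{(b-a)^2}{4}$,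 i.e. the real root whose modulus is strictly larger than that of every other complex root. Then $\lambda$ exists and is unique, $\lambda>1$, and, with $\zeta=\frac{\log(2\lambda)}{\log\lambda}$, $$p_{\mathcal{C}_f^\infty}(n)=O(n^\zeta)\qquad (n\to\infty).$$ Moreover this improves the earlier upper bound $p_{\mathcal{C}_f^\infty}(n)\le n^\beta$ (for $n$ large) of Sing, where $\beta=\frac{\log(2b^2)}{\log\left(\frac{2ab}{a+b}\right)}$, in the sense that $\zeta<\beta$. -/

import Mathlib

namespace FSmooth

/-- `u` is a finite word over the alphabet `{a, b}`. -/
def IsWord (a b : ℕ) (u : List ℕ) : Prop := ∀ c ∈ u, c = a ∨ c = b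

/-- The exponents `[p₁, …, pₙ]` of the canonical factorization `a₁^p₁ ⋯ aₙ^pₙ` of a word into
maximal blocks of equal letters (the empty list for the empty word). -/
def exponents (u : List ℕ) : List ℕ := (u.splitBy (· == ·)).map List.length

/-- A word over `{a, b}` is derivable if its first and last exponents are in `[1, b]` and all the
other exponents are in `{a, b}`. -/
def IsDerivable (a b : ℕ) (u : List ℕ) : Prop :=
  IsWord a b u ∧
  (∀ p ∈ (exponents u).head?, 1 ≤ p ∧ p ≤ b) ∧
  (∀ p ∈ (exponents u).getLast?, 1 ≤ p ∧ p ≤ b) ∧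
  ∀ p ∈ (exponents u).tail.dropLast, p = a ∨ p = b

/-- The empty word if `p ≤ a`, and the one-letter word `b` if `a < p`. -/
def cut (a b p : ℕ) : List ℕ := if p ≤ a then [] else [b]

/-- The operation on exponents behind the finite derivative: the first and the last exponents
are cut, the others are kept, and a single exponent is cut only once. -/
def cutEnds (a b : ℕ) : List ℕ → List ℕ
  | [] => []
  | [p] => cut a b p
  | p :: q :: ps =>
      cut a b p ++ (q :: ps).dropLast ++ cut a b ((q :: ps).getLast (List.cons_ne_nil q ps))

/-- The finite derivative `D_f` (meaningful on derivable words). -/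
def derivative (a b : ℕ) (u : List ℕ) : List ℕ := cutEnds a b (exponents u)

/-- The set of words over `{a, b}` that are derivable `n` times; for `n = 0` this is the set of
all words over `{a, b}`, and for `n = 1` it is the set of derivable words. -/
def derivableTimes (a b : ℕ) : ℕ → Set (List ℕ)
  | 0 => {u | IsWord a b u}
  | n + 1 => {u | IsDerivable a b u ∧ derivative a b u ∈ derivableTimes a b n}

/-- The set of f-smooth words over `{a, b}`: the finite words that are infinitely derivable. -/
def fSmooth (a b : ℕ) : Set (List ℕ) := {u | ∀ n : ℕ, 1 ≤ n → u ∈ derivableTimes a b n}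

/-- The complexity of a language: the number of its words of length `n`. -/
noncomputable def complexity (L : Set (List ℕ)) (n : ℕ) : ℕ := {u ∈ L | u.length = n}.ncard

/-- The real number `r` is the dominant root of the real polynomial `P`: it is a root, and every
other complex root has strictly smaller modulus. -/
def IsDominantRoot (P : Polynomial ℝ) (r : ℝ) : Prop :=
  P.IsRoot r ∧ ∀ z : ℂ, Polynomial.aeval z P = 0 → z ≠ (r : ℂ) → ‖z‖ < |r|

/-- The polynomial `X³ - (a+b)/2 X² + (b-a)²/4`. -/
noncomputable def cubic (a b : ℕ) : Polynomial ℝ :=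
  Polynomial.X ^ 3 - Polynomial.C (((a : ℝ) + b) / 2) * Polynomial.X ^ 2 +
    Polynomial.C (((b : ℝ) - a) ^ 2 / 4)

/-- `lam` is the number `λ` attached to the odd alphabet `{a, b}`. -/
def IsLambda (a b : ℕ) (lam : ℝ) : Prop :=
  (a = 1 → lam = (1 + Real.sqrt (2 * (b : ℝ) - 1)) / 2) ∧
  (a ≠ 1 → IsDominantRoot (cubic a b) lam)

end FSmooth

/-!
The count of f-smooth words is reduced to the count of bispecial ones, which form a binary tree
whose levels grow geometrically in length.

Let `S` be the language of f-smooth words. It is closed under removing the first or the last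
letter (`fSmooth_tail`, `fSmooth_dropLast`), because doing so to a derivable word removes at most
one letter at the same end of its derivative. Hence the first difference of the complexity is at
most the number of right special words, and the first difference of the latter is at most the
number of words `u` with `x u y ∈ S` for all letters `x, y`, here called *bispecial*
(`complexity_succ`, `ncard_rightSpecial_succ`).

A nonempty bispecial word is `x^a`, or has exponents `a, v, a` with `v` its derivative, again
bispecial (`bispecial_structure`). So each nonempty bispecial word is the derivative of at most two
bispecial words, and all of them but the empty one lie in sets `level a b k` of at most `4 * 2 ^ k`
words (`bispecial_mem_level`, `card_level_le`).

The words of level `k` have length at least `c * λ ^ k`. Let `s = (a+b)/2` and `d = (b-a)/2`, let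
`ℓ` be the length of a word, `T` the number of `a` minus the number of `b`, and `A` the same
difference with the alternating weights `1, -1, 1, ...`. Since all exponents are odd, passing from
`v` to a word with exponents `a, v, a` gives `ℓ' = s ℓ - d T + 2a`, `|T'| ≤ d |A| + O(1)` and
`|A'| = ℓ + 2` (`extend_estimates`). Up to bounded terms, `ℓ - (d/λ) T - (d/λ)² |A|` is therefore
multiplied by at least `λ` as soon as `s - (d/λ)² = λ`, which is the cubic equation; for `λ > d` it
is comparable with `ℓ` because `T + |A| ≤ ℓ + 1` (`length_lower_bound_of_cubic`). For `a = 1` the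
last inequality gives `ℓ'' ≥ ℓ' + d ℓ` directly, and `λ² = λ + d` (`length_lower_bound_of_one`).

Thus there are `O(2 ^ (log n / log λ)) = O(n ^ (log 2 / log λ))` bispecial words of length less
than `n`, and summing twice gives the bound on the complexity (`complexity_isBigO`). Finally
`ζ < β` follows from the fact that `λ` is at least the harmonic mean of `a` and `b`
(`IsLambda.spec`, `log_ratio_lt`).
-/

namespace FSmooth

/-! ### Blocks and exponents, and closure of the f-smooth words under factors -/

/-- The word `x^p₁ y^p₂ x^p₃ ⋯` with alternating letters and the given exponents. -/
def blocks : ℕ → ℕ → List ℕ → List ℕ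
  | _, _, [] => []
  | x, y, p :: ps => List.replicate p x ++ blocks y x ps

@[simp] lemma blocks_nil (x y : ℕ) : blocks x y [] = [] := rfl

@[simp] lemma blocks_cons (x y p : ℕ) (ps : List ℕ) :
    blocks x y (p :: ps) = List.replicate p x ++ blocks y x ps := rfl

lemma head?_blocks {x y : ℕ} : ∀ {ps : List ℕ}, (∀ p ∈ ps, 1 ≤ p) →
    ∀ z ∈ (blocks x y ps).head?, z = x
  | [], _, z, hz => by simp at hz
  | p :: ps, h, z, hz => by
    obtain ⟨q, rfl⟩ : ∃ q, p = q + 1 := ⟨p - 1, by have := h p (by simp); omega⟩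
    simpa [List.replicate_succ, eq_comm] using hz

lemma exponents_replicate {p : ℕ} (hp : 1 ≤ p) (x : ℕ) :
    exponents (List.replicate p x) = [p] := by
  unfold exponents
  rw [List.splitBy_of_isChain]
  · simp
  · simp; omega
  · apply List.isChain_replicate_of_rel
    simp

lemma exponents_append {u v : List ℕ} (h : ∀ x ∈ u.getLast?, ∀ y ∈ v.head?, x ≠ y) :
    exponents (u ++ v) = exponents u ++ exponents v := by
  unfold exponents
  rw [List.splitBy_append, List.map_append]
  intro x hx y hy
  simpa using h x hx y hy

lemma exponents_blocks {x y : ℕ} (hxy : x ≠ y) {ps : List ℕ} (h : ∀ p ∈ ps, 1 ≤ p) :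
    exponents (blocks x y ps) = ps := by
  induction ps generalizing x y with
  | nil => rfl
  | cons p ps ih =>
    have h' : ∀ q ∈ ps, 1 ≤ q := fun q hq => h q (by simp [hq])
    rw [blocks_cons, exponents_append, exponents_replicate (h p (by simp)), ih hxy.symm h']
    · rfl
    · intro z hz w hw
      rw [head?_blocks h' w hw, List.eq_of_mem_replicate (List.mem_of_mem_getLast? hz)]
      exact hxy

lemma exponents_reverse_blocks {x y : ℕ} (hxy : x ≠ y) {ps : List ℕ} (h : ∀ p ∈ ps, 1 ≤ p) :
    exponents (blocks x y ps).reverse = ps.reverse := by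
  induction ps generalizing x y with
  | nil => rfl
  | cons p ps ih =>
    have h' : ∀ q ∈ ps, 1 ≤ q := fun q hq => h q (by simp [hq])
    rw [blocks_cons, List.reverse_append, List.reverse_replicate, exponents_append,
      exponents_replicate (h p (by simp)), ih hxy.symm h']
    · simp
    · intro w hw z hz
      rw [List.getLast?_reverse] at hw
      rw [head?_blocks h' w hw, List.eq_of_mem_replicate (List.mem_of_mem_head? hz)]
      exact hxy.symm

lemma exists_blocks {a b : ℕ} {u : List ℕ} (hu : IsWord a b u) :
    ∃ x y ps, (x = a ∧ y = b ∨ x = b ∧ y = a) ∧ (∀ p ∈ ps, 1 ≤ p) ∧ u = blocks x y ps := by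
  induction u with
  | nil => exact ⟨a, b, [], by simp, by simp, rfl⟩
  | cons c u ih =>
    obtain ⟨x, y, ps, hxy, hps, rfl⟩ := ih fun d hd => hu d (by simp [hd])
    have key : (c = x ∨ c = y) := by
      have := hu c (by simp)
      omega
    rcases key with rfl | rfl
    · rcases ps with _ | ⟨p, ps⟩
      · exact ⟨c, y, [1], hxy, by simp, by simp⟩
      · refine ⟨c, y, (p + 1) :: ps, hxy, ?_, by simp [List.replicate_succ]⟩
        intro q hq
        rcases List.mem_cons.1 hq with rfl | hq
        · omega
        · exact hps q (by simp [hq])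
    · refine ⟨c, x, 1 :: ps, by omega, ?_, by simp⟩
      intro q hq
      rcases List.mem_cons.1 hq with rfl | hq
      · omega
      · exact hps q hq

lemma isWord_blocks {a b : ℕ} {x y : ℕ} (hx : x = a ∨ x = b) (hy : y = a ∨ y = b) (ps : List ℕ) :
    IsWord a b (blocks x y ps) := by
  induction ps generalizing x y with
  | nil => simp [IsWord]
  | cons p ps ih =>
    intro c hc
    rw [blocks_cons, List.mem_append] at hc
    rcases hc with hc | hc
    · rwa [List.eq_of_mem_replicate hc]
    · exact ih hy hx c hc

/-- After the blocks with exponents `ps`, the same two letters go on alternating. -/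
lemma blocks_append (x y : ℕ) (ps : List ℕ) : ∃ z z', (z = x ∧ z' = y ∨ z = y ∧ z' = x) ∧
    ∀ qs, blocks x y (ps ++ qs) = blocks x y ps ++ blocks z z' qs := by
  induction ps generalizing x y with
  | nil => exact ⟨x, y, by simp, by simp⟩
  | cons p ps ih =>
    obtain ⟨z, z', h, h'⟩ := ih y x
    exact ⟨z, z', by omega, fun qs => by simp [h']⟩

lemma exponents_reverse {a b : ℕ} (hab : a ≠ b) {u : List ℕ} (hu : IsWord a b u) :
    exponents u.reverse = (exponents u).reverse := by
  obtain ⟨x, y, ps, hxy, hps, rfl⟩ := exists_blocks hu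
  have : x ≠ y := by omega
  rw [exponents_reverse_blocks this hps, exponents_blocks this hps]

lemma list_cases (l : List ℕ) : l = [] ∨ (∃ p, l = [p]) ∨ ∃ p m q, l = p :: (m ++ [q]) := by
  rcases l with _ | ⟨p, l⟩
  · simp
  · rcases List.eq_nil_or_concat l with rfl | ⟨m, q, rfl⟩
    · simp
    · right; right; exact ⟨p, m, q, by simp⟩

lemma cutEnds_cons_concat (a b p q : ℕ) (m : List ℕ) :
    cutEnds a b (p :: (m ++ [q])) = cut a b p ++ m ++ cut a b q := by
  rcases m with _ | ⟨r, m⟩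
  · simp [cutEnds]
  · simp only [List.cons_append, cutEnds]
    congr 2
    · rw [← List.cons_append, List.dropLast_concat]
    · simp

lemma reverse_cut (a b p : ℕ) : (cut a b p).reverse = cut a b p := by
  unfold cut; split <;> rfl

lemma cutEnds_reverse (a b : ℕ) (l : List ℕ) :
    cutEnds a b l.reverse = (cutEnds a b l).reverse := by
  rcases list_cases l with rfl | ⟨p, rfl⟩ | ⟨p, m, q, rfl⟩
  · rfl
  · simp [cutEnds, reverse_cut]
  · simp [cutEnds_cons_concat, reverse_cut]

/-- The condition on the exponents of a derivable word. -/
def DerivableExponents (a b : ℕ) (l : List ℕ) : Prop :=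
  (∀ p ∈ l.head?, 1 ≤ p ∧ p ≤ b) ∧ (∀ p ∈ l.getLast?, 1 ≤ p ∧ p ≤ b) ∧
  ∀ p ∈ l.tail.dropLast, p = a ∨ p = b

lemma derivableExponents_singleton {a b p : ℕ} :
    DerivableExponents a b [p] ↔ 1 ≤ p ∧ p ≤ b := by
  simp [DerivableExponents]

lemma derivableExponents_cons_concat {a b p q : ℕ} {m : List ℕ} :
    DerivableExponents a b (p :: (m ++ [q])) ↔
      (1 ≤ p ∧ p ≤ b) ∧ (1 ≤ q ∧ q ≤ b) ∧ ∀ r ∈ m, r = a ∨ r = b := by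
  have : (p :: (m ++ [q])).getLast? = some q := by
    rw [← List.cons_append, List.getLast?_concat]
  simp [DerivableExponents, this]

lemma DerivableExponents.reverse {a b : ℕ} {l : List ℕ} (h : DerivableExponents a b l) :
    DerivableExponents a b l.reverse := by
  rcases list_cases l with rfl | ⟨p, rfl⟩ | ⟨p, m, q, rfl⟩
  · simpa using h
  · simpa using h
  · rw [derivableExponents_cons_concat] at h
    have : (p :: (m ++ [q])).reverse = q :: (m.reverse ++ [p]) := by simp
    rw [this, derivableExponents_cons_concat]
    exact ⟨h.2.1, h.1, fun r hr => h.2.2 r (by simpa using hr)⟩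

lemma isDerivable_iff {a b : ℕ} {u : List ℕ} :
    IsDerivable a b u ↔ IsWord a b u ∧ DerivableExponents a b (exponents u) := Iff.rfl

lemma IsWord.reverse {a b : ℕ} {u : List ℕ} (h : IsWord a b u) : IsWord a b u.reverse :=
  fun c hc => h c (by simpa using hc)

lemma IsWord.tail {a b : ℕ} {u : List ℕ} (h : IsWord a b u) : IsWord a b u.tail :=
  fun c hc => h c (List.mem_of_mem_tail hc)

lemma reverse_mem_derivableTimes {a b : ℕ} (hab : a ≠ b) {n : ℕ} {u : List ℕ}
    (h : u ∈ derivableTimes a b n) : u.reverse ∈ derivableTimes a b n := by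
  induction n generalizing u with
  | zero => exact IsWord.reverse h
  | succ n ih =>
    obtain ⟨h1, h2⟩ := h
    rw [isDerivable_iff] at h1
    refine ⟨isDerivable_iff.2 ⟨h1.1.reverse, ?_⟩, ?_⟩
    · rw [exponents_reverse hab h1.1]; exact h1.2.reverse
    · unfold derivative
      rw [exponents_reverse hab h1.1, cutEnds_reverse]
      exact ih h2

lemma cut_of_le {a b p : ℕ} (h : p ≤ a) : cut a b p = [] := by simp [cut, h]

lemma cut_of_lt {a b p : ℕ} (h : a < p) : cut a b p = [b] := by simp [cut, h]

/-- Removing the first letter of a derivable word keeps it derivable, and removes at most the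
first letter of its derivative. -/
lemma isDerivable_tail {a b : ℕ} (ha : 1 ≤ a) (hab : a < b) {u : List ℕ}
    (h : IsDerivable a b u) : IsDerivable a b u.tail ∧
      (derivative a b u.tail = derivative a b u ∨
        derivative a b u.tail = (derivative a b u).tail) := by
  rw [isDerivable_iff] at h ⊢
  obtain ⟨x, y, ps, hxy, hps, rfl⟩ := exists_blocks h.1
  have hne : x ≠ y := by omega
  rw [exponents_blocks hne hps] at h
  refine and_assoc.2 ⟨h.1.tail, ?_⟩
  have hd := h.2
  unfold derivative
  rw [exponents_blocks hne hps]
  -- Shortening the first block by one letter only matters if its length drops from `a + 1` to `a`.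
  have hcut : ∀ p, 1 ≤ p → ∀ w, cut a b p ++ w = cut a b (p + 1) ++ w ∨
      cut a b p ++ w = (cut a b (p + 1) ++ w).tail := by
    intro p hp w
    rcases lt_trichotomy p a with h | h | h
    · left; rw [cut_of_le h.le, cut_of_le h]
    · right; rw [cut_of_le h.le, cut_of_lt (by omega)]; simp
    · left; rw [cut_of_lt h, cut_of_lt (by omega)]
  rcases ps with _ | ⟨p, ps⟩
  · exact ⟨by simpa [exponents] using hd, by simp [exponents, cutEnds]⟩
  obtain rfl | ⟨r, rfl, hr⟩ : p = 1 ∨ ∃ r, p = r + 1 ∧ 1 ≤ r := by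
    have := hps p (by simp)
    rcases Nat.lt_or_ge 1 p with h | h
    · exact Or.inr ⟨p - 1, by omega, by omega⟩
    · left; omega
  · have htail : (blocks x y (1 :: ps)).tail = blocks y x ps := by simp
    rw [htail, exponents_blocks hne.symm fun q hq => hps q (by simp [hq])]
    rcases List.eq_nil_or_concat ps with rfl | ⟨m, q, rfl⟩
    · simp [DerivableExponents, cutEnds, cut_of_le ha]
    · rw [List.concat_eq_append] at *
      rw [derivableExponents_cons_concat] at hd
      rw [cutEnds_cons_concat]
      rcases m with _ | ⟨r, m⟩
      · rw [List.nil_append, derivableExponents_singleton]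
        exact ⟨hd.2.1, by simp [cutEnds, cut_of_le ha]⟩
      · rw [List.cons_append, derivableExponents_cons_concat, cutEnds_cons_concat]
        refine ⟨⟨?_, hd.2.1, fun r hr => hd.2.2 r (by simp [hr])⟩, ?_⟩
        · have := hd.2.2 r (by simp)
          omega
        · rcases hd.2.2 r (by simp) with rfl | rfl
          · right; simp [cut_of_le ha, cut_of_le le_rfl]
          · left; simp [cut_of_le ha, cut_of_lt hab]
  · have htail : (blocks x y ((r + 1) :: ps)).tail = blocks x y (r :: ps) := by
      simp [List.replicate_succ]
    have hpos : ∀ q ∈ r :: ps, 1 ≤ q := by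
      intro q hq
      rcases List.mem_cons.1 hq with rfl | hq
      · exact hr
      · exact hps q (by simp [hq])
    rw [htail, exponents_blocks hne hpos]
    rcases List.eq_nil_or_concat ps with rfl | ⟨m, q, rfl⟩
    · rw [derivableExponents_singleton] at hd ⊢
      refine ⟨by omega, ?_⟩
      simpa [cutEnds] using hcut r hr []
    · rw [List.concat_eq_append] at *
      rw [derivableExponents_cons_concat] at hd ⊢
      rw [cutEnds_cons_concat, cutEnds_cons_concat]
      refine ⟨⟨by omega, hd.2⟩, ?_⟩
      simpa using hcut r hr (m ++ cut a b q)

lemma tail_mem_derivableTimes {a b : ℕ} (ha : 1 ≤ a) (hab : a < b) {n : ℕ} {u : List ℕ}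
    (h : u ∈ derivableTimes a b n) : u.tail ∈ derivableTimes a b n := by
  induction n generalizing u with
  | zero => exact IsWord.tail h
  | succ n ih =>
    obtain ⟨h1, h2⟩ := h
    obtain ⟨h3, h4⟩ := isDerivable_tail ha hab h1
    refine ⟨h3, ?_⟩
    rcases h4 with h4 | h4 <;> rw [h4]
    exacts [h2, ih h2]

lemma fSmooth_tail {a b : ℕ} (ha : 1 ≤ a) (hab : a < b) {u : List ℕ}
    (h : u ∈ fSmooth a b) : u.tail ∈ fSmooth a b :=
  fun n hn => tail_mem_derivableTimes ha hab (h n hn)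

lemma fSmooth_dropLast {a b : ℕ} (ha : 1 ≤ a) (hab : a < b) {u : List ℕ}
    (h : u ∈ fSmooth a b) : u.dropLast ∈ fSmooth a b := by
  intro n hn
  have := reverse_mem_derivableTimes hab.ne
    (tail_mem_derivableTimes ha hab (reverse_mem_derivableTimes hab.ne (h n hn)))
  simpa using this

lemma isDerivable_of_fSmooth {a b : ℕ} {u : List ℕ} (h : u ∈ fSmooth a b) : IsDerivable a b u :=
  (h 1 le_rfl).1

lemma derivative_mem_fSmooth {a b : ℕ} {u : List ℕ} (h : u ∈ fSmooth a b) :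
    derivative a b u ∈ fSmooth a b :=
  fun n _ => (h (n + 1) (by omega)).2

/-! ### Bispecial words -/

/-- The words all of whose two-sided extensions by one letter on each side are f-smooth. -/
def bispecial (a b : ℕ) : Set (List ℕ) :=
  {u | ∀ x y, (x = a ∨ x = b) → (y = a ∨ y = b) → x :: (u ++ [y]) ∈ fSmooth a b}

lemma fSmooth_blocks {a b x y : ℕ} (hxy : x ≠ y) {ps : List ℕ} (hps : ∀ p ∈ ps, 1 ≤ p)
    (h : blocks x y ps ∈ fSmooth a b) :
    DerivableExponents a b ps ∧ cutEnds a b ps ∈ fSmooth a b := by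
  have h1 := (isDerivable_iff.1 (isDerivable_of_fSmooth h)).2
  have h2 := derivative_mem_fSmooth h
  unfold derivative at h2
  rw [exponents_blocks hxy hps] at h1 h2
  exact ⟨h1, h2⟩

lemma one_le_of_mem_cons_concat {p q : ℕ} {m : List ℕ} (hp : 1 ≤ p) (hm : ∀ r ∈ m, 1 ≤ r)
    (hq : 1 ≤ q) : ∀ r ∈ p :: (m ++ [q]), 1 ≤ r := by
  intro r hr
  rcases List.mem_cons.1 hr with rfl | hr
  · exact hp
  rcases List.mem_append.1 hr with hr | hr
  · exact hm r hr
  · rwa [List.mem_singleton.1 hr]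

/-- A nonempty bispecial word is `c^a`, or begins and ends with a block of length `a`, and the
exponents in between form its derivative, which is again bispecial: extending the word by a
letter extends the derivative by `b` if the outer block grows to `a + 1`, and by `a` if a new
block is opened. -/
lemma bispecial_structure {a b : ℕ} (ha : 1 ≤ a) (hab : a < b) {u : List ℕ}
    (hu : u ∈ bispecial a b) (hne : u ≠ []) :
    ∃ x y, (x = a ∧ y = b ∨ x = b ∧ y = a) ∧
      (u = blocks x y [a] ∨ ∃ v ∈ bispecial a b, u = blocks x y (a :: (v ++ [a]))) := by
  have hw : IsWord a b u := fun c hc =>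
    (isDerivable_of_fSmooth (hu a a (by simp) (by simp))).1 c (by simp [hc])
  obtain ⟨x, y, ps, hxy, hps, rfl⟩ := exists_blocks hw
  have hne' : x ≠ y := by omega
  have hx : x = a ∨ x = b := by omega
  have hy : y = a ∨ y = b := by omega
  refine ⟨x, y, hxy, ?_⟩
  rcases list_cases ps with rfl | ⟨p, rfl⟩ | ⟨p, m, q, rfl⟩
  · simp at hne
  · left
    have hp := hps p (by simp)
    -- The extension by `y` on both sides gives `p ∈ {a, b}`, the one by `x` gives `p + 2 ≤ b`.
    have h1 := hu y y hy hy
    have h2 := hu x x hx hx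
    have e1 : y :: (blocks x y [p] ++ [y]) = blocks y x (1 :: ([p] ++ [1])) := by simp
    have e2 : x :: (blocks x y [p] ++ [x]) = blocks x y [p + 2] := by
      simp only [blocks_cons, blocks_nil, List.append_nil]
      rw [← List.replicate_succ', ← List.replicate_succ]
    rw [e1] at h1
    rw [e2] at h2
    have h1 := (derivableExponents_cons_concat.1
      (fSmooth_blocks hne'.symm (by simp [hp]) h1).1).2.2 p (by simp)
    have h2 := (derivableExponents_singleton.1 (fSmooth_blocks hne' (by simp) h2).1).2
    have : p = a := by omega
    rw [this]
  · right
    have hp := hps p (by simp)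
    have hq := hps q (by simp)
    have hm : ∀ r ∈ m, 1 ≤ r := fun r hr => hps r (by simp [hr])
    obtain ⟨z, z', hz, happ⟩ := blocks_append x y (p :: m)
    have hzw : z = a ∨ z = b := by omega
    have hzw' : z' = a ∨ z' = b := by omega
    have eu : blocks x y (p :: (m ++ [q])) = blocks x y (p :: m) ++ blocks z z' [q] := by
      rw [← happ]; simp
    have ez : blocks x y (p :: (m ++ [q])) ++ [z] = blocks x y (p :: (m ++ [q + 1])) := by
      rw [eu, ← List.cons_append, happ]
      simp [List.replicate_succ']
    have ez' : blocks x y (p :: (m ++ [q])) ++ [z'] = blocks x y (p :: ((m ++ [q]) ++ [1])) := by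
      have := happ [q, 1]
      have e : p :: ((m ++ [q]) ++ [1]) = p :: m ++ [q, 1] := by simp
      rw [eu, e, this]
      simp
    have ex : ∀ l, x :: blocks x y (p :: l) = blocks x y ((p + 1) :: l) := by
      intro l; simp [List.replicate_succ]
    have ey : ∀ l, y :: blocks x y (p :: l) = blocks y x (1 :: (p :: l)) := by
      intro l; simp
    have h11 := hu x z hx hzw
    have h12 := hu x z' hx hzw'
    have h21 := hu y z hy hzw
    have h22 := hu y z' hy hzw'
    rw [ez, ex] at h11
    rw [ez', ex] at h12
    rw [ez, ey, ← List.cons_append] at h21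
    rw [ez', ey, ← List.cons_append] at h22
    have hpm : ∀ r ∈ p :: m, 1 ≤ r := by simpa [hp] using hm
    have hmq : ∀ r ∈ m ++ [q], 1 ≤ r := fun r hr => hps r (by simp_all)
    have hpmq : ∀ r ∈ p :: m ++ [q], 1 ≤ r := fun r hr => hps r (by simpa using hr)
    obtain ⟨d11, s11⟩ :=
      fSmooth_blocks hne' (one_le_of_mem_cons_concat (by omega) hm (by omega)) h11
    obtain ⟨d12, s12⟩ :=
      fSmooth_blocks hne' (one_le_of_mem_cons_concat (by omega) hmq le_rfl) h12
    obtain ⟨d21, s21⟩ :=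
      fSmooth_blocks hne'.symm (one_le_of_mem_cons_concat le_rfl hpm (by omega)) h21
    obtain ⟨d22, s22⟩ :=
      fSmooth_blocks hne'.symm (one_le_of_mem_cons_concat le_rfl hpmq le_rfl) h22
    rw [derivableExponents_cons_concat] at d11 d22
    -- New blocks on both sides give `p, q ∈ {a, b}`; longer outer blocks give `p + 1, q + 1 ≤ b`.
    have hpa := d22.2.2 p (by simp)
    have hqa := d22.2.2 q (by simp)
    obtain rfl : p = a := by omega
    obtain rfl : q = p := by omega
    rw [cutEnds_cons_concat] at s11 s12 s21 s22
    have c1 := cut_of_le (b := b) ha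
    have c2 : cut q b (q + 1) = [b] := cut_of_lt (by omega)
    refine ⟨m, ?_, rfl⟩
    rintro X Y (rfl | rfl) (rfl | rfl)
    · simpa [c1, c2] using s22
    · simpa [c1, c2] using s21
    · simpa [c1, c2] using s12
    · simpa [c1, c2] using s11

/-- The words `x^a`, `x^a y^a`, and their successive images under the map sending `v` to the two
words with exponents `a, v, a`. -/
def level (a b : ℕ) : ℕ → Finset (List ℕ)
  | 0 => {blocks a b [a], blocks b a [a], blocks a b [a, a], blocks b a [a, a]}
  | k + 1 => (level a b k).image (fun v => blocks a b (a :: (v ++ [a]))) ∪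
      (level a b k).image (fun v => blocks b a (a :: (v ++ [a])))

lemma card_level_le (a b k : ℕ) : (level a b k).card ≤ 4 * 2 ^ k := by
  induction k with
  | zero => exact Finset.card_le_four
  | succ k ih =>
    rw [level]
    refine (Finset.card_union_le _ _).trans ?_
    have h1 := Finset.card_image_le (s := level a b k) (f := fun v => blocks a b (a :: (v ++ [a])))
    have h2 := Finset.card_image_le (s := level a b k) (f := fun v => blocks b a (a :: (v ++ [a])))
    rw [pow_succ]
    omega

lemma mem_level_succ {a b k : ℕ} {u : List ℕ} : u ∈ level a b (k + 1) ↔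
    ∃ v ∈ level a b k, ∃ x y, (x = a ∧ y = b ∨ x = b ∧ y = a) ∧
      u = blocks x y (a :: (v ++ [a])) := by
  simp only [level, Finset.mem_union, Finset.mem_image]
  constructor
  · rintro (⟨v, hv, rfl⟩ | ⟨v, hv, rfl⟩)
    · exact ⟨v, hv, a, b, by simp, rfl⟩
    · exact ⟨v, hv, b, a, by simp, rfl⟩
  · rintro ⟨v, hv, x, y, (⟨rfl, rfl⟩ | ⟨rfl, rfl⟩), rfl⟩
    · exact Or.inl ⟨v, hv, rfl⟩
    · exact Or.inr ⟨v, hv, rfl⟩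

lemma length_blocks (x y : ℕ) (ps : List ℕ) : (blocks x y ps).length = ps.sum := by
  induction ps generalizing x y with
  | nil => rfl
  | cons p ps ih => simp [ih]

lemma length_le_sum {l : List ℕ} (h : ∀ p ∈ l, 1 ≤ p) : l.length ≤ l.sum := by
  simpa using List.card_nsmul_le_sum l 1 h

lemma isWord_of_bispecial {a b : ℕ} {u : List ℕ} (hu : u ∈ bispecial a b) : IsWord a b u :=
  fun c hc => (isDerivable_of_fSmooth (hu a a (by simp) (by simp))).1 c (by simp [hc])

lemma bispecial_mem_level {a b : ℕ} (ha : 1 ≤ a) (hab : a < b) {u : List ℕ}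
    (hu : u ∈ bispecial a b) : u = [] ∨ ∃ k, u ∈ level a b k := by
  by_cases hne : u = []
  · exact Or.inl hne
  right
  obtain ⟨x, y, hxy, h⟩ := bispecial_structure ha hab hu hne
  rcases h with rfl | ⟨v, hv, rfl⟩
  · refine ⟨0, ?_⟩
    rcases hxy with ⟨rfl, rfl⟩ | ⟨rfl, rfl⟩ <;> simp [level]
  · have hlt : v.length < (blocks x y (a :: (v ++ [a]))).length := by
      have h : v.length ≤ v.sum := length_le_sum fun p hp => by
        have := isWord_of_bispecial hv p hp
        omega
      rw [length_blocks]
      simp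
      omega
    rcases bispecial_mem_level ha hab hv with rfl | ⟨k, hk⟩
    · refine ⟨0, ?_⟩
      rcases hxy with ⟨rfl, rfl⟩ | ⟨rfl, rfl⟩ <;> simp [level]
    · exact ⟨k + 1, mem_level_succ.2 ⟨v, hk, x, y, hxy, rfl⟩⟩
termination_by u.length

/-! ### Growth of the lengths of bispecial words -/

/-- The sign of a letter of the alphabet `{a, b}`: `1` for `a` and `-1` for `b`. -/
noncomputable def letterSign (a c : ℕ) : ℝ := if c = a then 1 else -1

/-- The number of letters `a` minus the number of letters `b`. -/
noncomputable def excess (a : ℕ) : List ℕ → ℝ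
  | [] => 0
  | c :: w => letterSign a c + excess a w

/-- The sum of the letter signs, weighted by `1, -1, 1, ...` along the word. -/
noncomputable def altExcess (a : ℕ) : List ℕ → ℝ
  | [] => 0
  | c :: w => letterSign a c - altExcess a w

/-- The alternating sum `1 - 1 + 1 - ⋯` with as many terms as the word has letters. -/
noncomputable def altLength : List ℕ → ℝ
  | [] => 0
  | _ :: w => 1 - altLength w

lemma altLength_mem (w : List ℕ) : 0 ≤ altLength w ∧ altLength w ≤ 1 := by
  induction w with
  | nil => simp [altLength]
  | cons c w ih => simp only [altLength]; constructor <;> linarith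

lemma letterSign_eq (a c : ℕ) : letterSign a c = 1 ∨ letterSign a c = -1 := by
  unfold letterSign; split <;> simp

lemma excess_add_altExcess_le (a : ℕ) (w : List ℕ) :
    excess a w + altExcess a w ≤ w.length + 1 ∧ excess a w - altExcess a w ≤ w.length := by
  induction w with
  | nil => simp [excess, altExcess]
  | cons c w ih =>
    simp only [excess, altExcess, List.length_cons, Nat.cast_add, Nat.cast_one]
    rcases letterSign_eq a c with h | h <;> rw [h] <;> constructor <;> linarith

/-- Each of `excess ± altExcess` counts, with a factor `2`, only every other letter. -/
lemma excess_add_abs_altExcess_le (a : ℕ) (w : List ℕ) :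
    excess a w + |altExcess a w| ≤ w.length + 1 := by
  have := excess_add_altExcess_le a w
  rcases abs_cases (altExcess a w) with h | h <;> linarith

lemma abs_excess_le (a : ℕ) (w : List ℕ) : |excess a w| ≤ w.length := by
  induction w with
  | nil => simp [excess]
  | cons c w ih =>
    simp only [excess, List.length_cons, Nat.cast_add, Nat.cast_one]
    rw [abs_le] at ih ⊢
    rcases letterSign_eq a c with h | h <;> rw [h] <;> constructor <;> linarith

lemma letter_eq {a b c : ℕ} (h : c = a ∨ c = b) :
    (c : ℝ) = ((a : ℝ) + b) / 2 - ((b : ℝ) - a) / 2 * letterSign a c := by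
  unfold letterSign
  by_cases hc : c = a
  · rw [if_pos hc, hc]; ring
  · rw [if_neg hc, h.resolve_left hc]; ring

lemma sum_eq {a b : ℕ} {w : List ℕ} (hw : IsWord a b w) :
    (w.sum : ℝ) = ((a : ℝ) + b) / 2 * w.length - ((b : ℝ) - a) / 2 * excess a w := by
  induction w with
  | nil => simp [excess]
  | cons c w ih =>
    have := ih fun d hd => hw d (by simp [hd])
    have hc := letter_eq (hw c (by simp))
    simp only [List.sum_cons, excess, List.length_cons, Nat.cast_add, Nat.cast_one]
    rw [this, hc]
    ring

lemma excess_replicate_append (a p x : ℕ) (u : List ℕ) :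
    excess a (List.replicate p x ++ u) = p * letterSign a x + excess a u := by
  induction p with
  | zero => simp
  | succ p ih =>
    simp only [List.replicate_succ, List.cons_append, excess, ih, Nat.cast_add, Nat.cast_one]
    ring

lemma altExcess_replicate_append (a : ℕ) {p : ℕ} (hp : Odd p) (x : ℕ) (u : List ℕ) :
    altExcess a (List.replicate p x ++ u) = letterSign a x - altExcess a u := by
  obtain ⟨k, rfl⟩ := hp
  induction k with
  | zero => simp [altExcess]
  | succ k ih =>
    have : 2 * (k + 1) + 1 = (2 * k + 1) + 1 + 1 := by ring
    rw [this, List.replicate_succ, List.replicate_succ]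
    simp only [List.cons_append, altExcess, ih]
    ring

lemma excess_blocks {a b x y : ℕ} (hxy : letterSign a y = -letterSign a x) {w : List ℕ}
    (hw : IsWord a b w) : excess a (blocks x y w) = letterSign a x *
      (((a : ℝ) + b) / 2 * altLength w - ((b : ℝ) - a) / 2 * altExcess a w) := by
  induction w generalizing x y with
  | nil => simp [excess, altLength, altExcess]
  | cons c w ih =>
    have := ih (x := y) (y := x) (by rw [hxy, neg_neg]) fun d hd => hw d (by simp [hd])
    rw [blocks_cons, excess_replicate_append, this, letter_eq (hw c (by simp)), hxy]
    simp only [altLength, altExcess]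
    ring

/-- As all blocks have odd length, the `j`-th block contributes its sign to the alternating
excess, with the weight `(-1)^j`; these products are all equal. -/
lemma altExcess_blocks {a x y : ℕ} (hxy : letterSign a y = -letterSign a x) {w : List ℕ}
    (hw : ∀ p ∈ w, Odd p) : altExcess a (blocks x y w) = letterSign a x * w.length := by
  induction w generalizing x y with
  | nil => simp [altExcess]
  | cons c w ih =>
    have := ih (x := y) (y := x) (by rw [hxy, neg_neg]) fun d hd => hw d (by simp [hd])
    rw [blocks_cons, altExcess_replicate_append a (hw c (by simp)), this, hxy]
    simp only [List.length_cons, Nat.cast_add, Nat.cast_one]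
    ring

lemma abs_altExcess_concat_sub (a c : ℕ) (w : List ℕ) :
    |altExcess a (w ++ [c]) - altExcess a w| ≤ 1 := by
  induction w with
  | nil => rcases letterSign_eq a c with h | h <;> simp [altExcess, h]
  | cons d w ih =>
    simp only [List.cons_append, altExcess]
    rw [abs_le] at ih ⊢
    constructor <;> linarith

/-- How length, excess and alternating excess change when a word `v` becomes the list of
the inner exponents of a word with outer exponents `a`. -/
lemma extend_estimates {a b x y : ℕ} (hab : a < b) (ha : Odd a) (hb : Odd b)
    (hxy : x = a ∧ y = b ∨ x = b ∧ y = a) {v : List ℕ} (hv : IsWord a b v) :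
    ((blocks x y (a :: (v ++ [a]))).length : ℝ) =
        ((a : ℝ) + b) / 2 * v.length - ((b : ℝ) - a) / 2 * excess a v + 2 * a ∧
    |excess a (blocks x y (a :: (v ++ [a])))| ≤
        ((a : ℝ) + b) / 2 + ((b : ℝ) - a) / 2 * (|altExcess a v| + 2) ∧
    |altExcess a (blocks x y (a :: (v ++ [a])))| = v.length + 2 := by
  have hs : letterSign a y = -letterSign a x := by
    rcases hxy with ⟨rfl, rfl⟩ | ⟨rfl, rfl⟩ <;> simp [letterSign, hab.ne']
  have hsx : |letterSign a x| = 1 := by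
    rcases letterSign_eq a x with h | h <;> simp [h]
  have hw : IsWord a b (a :: (v ++ [a])) := by
    intro c hc
    simp only [List.mem_cons, List.mem_append, List.not_mem_nil, or_false] at hc
    rcases hc with h | h | h
    exacts [Or.inl h, hv c h, Or.inl h]
  have hodd : ∀ p ∈ a :: (v ++ [a]), Odd p := by
    intro p hp
    rcases hw p hp with rfl | rfl
    exacts [ha, hb]
  refine ⟨?_, ?_, ?_⟩
  · rw [length_blocks]
    simp only [List.sum_cons, List.sum_append, List.sum_nil, Nat.cast_add, sum_eq hv,
      Nat.cast_zero]
    ring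
  · rw [excess_blocks hs hw, abs_mul, hsx, one_mul]
    have h1 := altLength_mem (a :: (v ++ [a]))
    have h2 : |altExcess a (a :: (v ++ [a]))| ≤ |altExcess a v| + 2 := by
      have h3 := abs_altExcess_concat_sub a a v
      simp only [altExcess]
      have h4 : letterSign a a = 1 := by simp [letterSign]
      rw [h4]
      rw [abs_le] at h3 ⊢
      rcases abs_cases (altExcess a v) with h | h <;> constructor <;> linarith
    have hd : (0 : ℝ) ≤ ((b : ℝ) - a) / 2 := by
      have : (a : ℝ) < b := by exact_mod_cast hab
      linarith
    have hs0 : (0 : ℝ) ≤ ((a : ℝ) + b) / 2 := by positivity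
    refine (abs_sub _ _).trans (add_le_add ?_ ?_)
    · rw [abs_of_nonneg (mul_nonneg hs0 h1.1)]
      exact mul_le_of_le_one_right hs0 h1.2
    · rw [abs_mul, abs_of_nonneg hd]
      exact mul_le_mul_of_nonneg_left h2 hd
  · rw [altExcess_blocks hs hodd, abs_mul, hsx, one_mul, abs_of_nonneg (by positivity)]
    simp
    ring

lemma isWord_of_mem_level {a b k : ℕ} {u : List ℕ} (hu : u ∈ level a b k) : IsWord a b u := by
  cases k with
  | zero =>
    simp only [level, Finset.mem_insert, Finset.mem_singleton] at hu
    rcases hu with rfl | rfl | rfl | rfl <;> exact isWord_blocks (by simp) (by simp) _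
  | succ k =>
    obtain ⟨v, -, x, y, hxy, rfl⟩ := mem_level_succ.1 hu
    exact isWord_blocks (by omega) (by omega) _

lemma lt_length_of_mem_level {a b k : ℕ} (ha : 1 ≤ a) (hab : a < b) {u : List ℕ}
    (hu : u ∈ level a b k) : k < u.length := by
  induction k generalizing u with
  | zero =>
    simp only [level, Finset.mem_insert, Finset.mem_singleton] at hu
    rcases hu with rfl | rfl | rfl | rfl <;> simp <;> omega
  | succ k ih =>
    obtain ⟨v, hv, x, y, hxy, rfl⟩ := mem_level_succ.1 hu
    have h1 := ih hv
    have h2 : v.length ≤ v.sum := length_le_sum fun p hp => by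
      have := isWord_of_mem_level hv p hp
      omega
    rw [length_blocks]
    simp
    omega

/-- For `a = 1` the lengths `ℓ_k` along a chain of levels satisfy the Fibonacci-like inequality
`ℓ_{k+2} ≥ ℓ_{k+1} + (b-1)/2 ℓ_k`. -/
lemma length_lower_bound_of_one {b : ℕ} (hab : 1 < b) (hb : Odd b) {lam : ℝ} (h1 : 1 < lam)
    (hlam : lam ^ 2 = lam + ((b : ℝ) - 1) / 2) (k : ℕ) {u : List ℕ} (hu : u ∈ level 1 b k) :
    lam⁻¹ * lam ^ k ≤ u.length := by
  have h0 : 0 < lam := by linarith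
  have hd : (0 : ℝ) < ((b : ℝ) - 1) / 2 := by
    have : (1 : ℝ) < b := by exact_mod_cast hab
    linarith
  have key : ∀ k, ∀ u ∈ level 1 b (k + 1),
      lam ^ k ≤ u.length ∧ lam ^ k ≤ lam * (|altExcess 1 u| - 1) := by
    intro k
    induction k with
    | zero =>
      intro u hu
      obtain ⟨v, hv, x, y, hxy, rfl⟩ := mem_level_succ.1 hu
      obtain ⟨-, -, e3⟩ := extend_estimates hab (by simp) hb hxy (isWord_of_mem_level hv)
      have := lt_length_of_mem_level le_rfl hab hu
      refine ⟨?_, ?_⟩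
      · rw [pow_zero]; exact_mod_cast (Nat.zero_lt_of_lt this)
      · rw [e3, pow_zero]
        have : (0 : ℝ) ≤ v.length := by positivity
        nlinarith
    | succ k ih =>
      intro u hu
      obtain ⟨v, hv, x, y, hxy, rfl⟩ := mem_level_succ.1 hu
      obtain ⟨e1, -, e3⟩ := extend_estimates hab (by simp) hb hxy (isWord_of_mem_level hv)
      obtain ⟨i1, i2⟩ := ih v hv
      have hcone := excess_add_abs_altExcess_le 1 v
      refine ⟨?_, ?_⟩
      · rw [e1]
        have h3 : ((b : ℝ) - 1) / 2 * excess 1 v ≤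
            ((b : ℝ) - 1) / 2 * (v.length + 1 - |altExcess 1 v|) :=
          mul_le_mul_of_nonneg_left (by linarith) hd.le
        have h4 : lam ^ k + ((b : ℝ) - 1) / 2 * (|altExcess 1 v| - 1) ≤ v.length +
          ((b : ℝ) - 1) / 2 * (|altExcess 1 v| - 1) := by linarith
        have h5 : lam * lam ^ (k + 1) ≤
            lam * (lam ^ k + ((b : ℝ) - 1) / 2 * (|altExcess 1 v| - 1)) := by
          have h6 : ((b : ℝ) - 1) / 2 * lam ^ k ≤
            ((b : ℝ) - 1) / 2 * (lam * (|altExcess 1 v| - 1)) :=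
            mul_le_mul_of_nonneg_left i2 hd.le
          have h7 : lam * lam ^ (k + 1) = lam * lam ^ k + ((b : ℝ) - 1) / 2 * lam ^ k := by
            rw [← add_mul, ← hlam]; ring
          rw [h7]
          linarith
        have h8 := le_of_mul_le_mul_left h5 h0
        push_cast
        linarith
      · rw [e3, pow_succ, mul_comm]
        apply mul_le_mul_of_nonneg_left _ h0.le
        linarith
  cases k with
  | zero =>
    have h2 := lt_length_of_mem_level le_rfl hab hu
    have h3 : (1 : ℝ) ≤ u.length := by exact_mod_cast h2
    rw [pow_zero, mul_one]
    exact (inv_le_one_of_one_le₀ h1.le).trans h3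
  | succ k =>
    rw [pow_succ, mul_comm, mul_assoc, mul_inv_cancel₀ h0.ne', mul_one]
    exact (key k u hu).1

/-- For `lam > (b-a)/2` the functional `ℓ - (d/lam) excess - (d/lam)² |altExcess|`, where `ℓ` is
the length and `d = (b-a)/2`, is comparable with the length, and grows by a factor of at least
`lam` from one level to the next, up to an additive constant. -/
lemma length_lower_bound_of_cubic {a b : ℕ} (hab : a < b) (ha : Odd a) (hb : Odd b) {lam : ℝ}
    (h1 : 1 < lam) (hd : ((b : ℝ) - a) / 2 < lam)
    (hlam : lam ^ 3 - ((a : ℝ) + b) / 2 * lam ^ 2 + (((b : ℝ) - a) / 2) ^ 2 = 0) :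
    ∃ c : ℝ, 0 < c ∧ ∀ k, ∀ u ∈ level a b k, c * lam ^ k ≤ u.length := by
  have ha1 : 1 ≤ a := ha.pos
  have h0 : 0 < lam := by linarith
  obtain ⟨d, hd_def⟩ : ∃ d : ℝ, d = ((b : ℝ) - a) / 2 := ⟨_, rfl⟩
  obtain ⟨s, hs_def⟩ : ∃ s : ℝ, s = ((a : ℝ) + b) / 2 := ⟨_, rfl⟩
  have hd0 : 0 < d := by
    have : (a : ℝ) < b := by exact_mod_cast hab
    linarith
  rw [← hd_def] at hd hlam
  rw [← hs_def] at hlam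
  obtain ⟨p, hp⟩ : ∃ p, p = d / lam := ⟨_, rfl⟩
  have hp0 : 0 < p := by rw [hp]; positivity
  have hp1 : p < 1 := by rw [hp, div_lt_one h0]; exact hd
  have hplam : p * lam = d := by rw [hp]; field_simp
  have hsp : s - p ^ 2 = lam := by
    rw [hp]; field_simp; linarith
  obtain ⟨K, hK⟩ : ∃ K, K = (p * s + 2 * p * d + 2 * p ^ 2) / (lam - 1) := ⟨_, rfl⟩
  have hK' : K * (lam - 1) = p * s + 2 * p * d + 2 * p ^ 2 := by
    rw [hK]; field_simp [sub_ne_zero.2 h1.ne']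
  set Φ : List ℕ → ℝ := fun u => u.length - p * excess a u - p ^ 2 * |altExcess a u| with hΦ
  have step : ∀ k, ∀ v ∈ level a b k, ∀ x y, (x = a ∧ y = b ∨ x = b ∧ y = a) →
      lam * (Φ v - K) ≤ Φ (blocks x y (a :: (v ++ [a]))) - K := by
    intro k v hv x y hxy
    obtain ⟨e1, e2, e3⟩ := extend_estimates hab ha hb hxy (isWord_of_mem_level hv)
    rw [← hd_def, ← hs_def] at e1 e2
    simp only [hΦ]
    rw [e1, e3]
    have h2 := mul_le_mul_of_nonneg_left ((le_abs_self _).trans e2) hp0.le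
    have ha0 : (0 : ℝ) ≤ a := by positivity
    have h3 : lam * (v.length - p * excess a v - p ^ 2 * |altExcess a v| - K) =
        (s - p ^ 2) * v.length - d * excess a v - p * d * |altExcess a v| - K * (lam - 1) - K := by
      rw [hsp, ← hplam]; ring
    rw [h3, hK']
    nlinarith
  have lower : ∀ u, (1 - p) * u.length - p ≤ Φ u := by
    intro u
    have h2 := mul_le_mul_of_nonneg_left (excess_add_abs_altExcess_le a u) hp0.le
    have h3 : p ^ 2 * |altExcess a u| ≤ p * |altExcess a u| :=
      mul_le_mul_of_nonneg_right (by nlinarith) (abs_nonneg _)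
    simp only [hΦ]
    linarith
  have upper : ∀ u, Φ u ≤ 2 * u.length := by
    intro u
    have h2 := mul_le_mul_of_nonneg_left ((neg_le_abs _).trans (abs_excess_le a u)) hp0.le
    have h3 : 0 ≤ p ^ 2 * |altExcess a u| := by positivity
    have h4 : p * u.length ≤ 1 * u.length :=
      mul_le_mul_of_nonneg_right hp1.le (by positivity)
    simp only [hΦ]
    linarith
  have hp1' : 0 < 1 - p := by linarith
  obtain ⟨k₀, hk₀⟩ := exists_nat_ge ((K + 1 + p) / (1 - p))
  rw [div_le_iff₀ hp1'] at hk₀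
  -- From level `k₀` on, the additive constant is absorbed.
  have grow : ∀ k, ∀ u ∈ level a b (k₀ + k), lam ^ k ≤ Φ u - K := by
    intro k
    induction k with
    | zero =>
      intro u hu
      have h2 : (k₀ : ℝ) ≤ u.length := by exact_mod_cast (lt_length_of_mem_level ha1 hab hu).le
      have h3 := lower u
      have h4 := mul_le_mul_of_nonneg_left h2 hp1'.le
      rw [pow_zero]
      linarith
    | succ k ih =>
      intro u hu
      obtain ⟨v, hv, x, y, hxy, rfl⟩ := mem_level_succ.1 hu
      refine le_trans ?_ (step _ v hv x y hxy)
      rw [pow_succ, mul_comm]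
      exact mul_le_mul_of_nonneg_left (ih v hv) h0.le
  have hK0 : 0 ≤ K := by
    have : 0 < s := by rw [hs_def]; positivity
    rw [hK]
    apply div_nonneg
    · positivity
    · linarith
  refine ⟨(2 * lam ^ k₀)⁻¹, by positivity, fun k u hu => ?_⟩
  rw [inv_mul_le_iff₀ (by positivity)]
  have hL : (1 : ℝ) ≤ u.length := by
    exact_mod_cast (Nat.zero_le _).trans_lt (lt_length_of_mem_level ha1 hab hu)
  rcases le_total k₀ k with h | h
  · obtain ⟨j, rfl⟩ := Nat.exists_eq_add_of_le h
    have h2 := grow j u hu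
    have h3 := upper u
    have h4 : lam ^ j ≤ 2 * u.length := by linarith
    rw [pow_add]
    nlinarith [pow_pos h0 k₀]
  · have h2 : lam ^ k ≤ lam ^ k₀ := pow_le_pow_right₀ h1.le h
    have := pow_pos h0 k₀
    nlinarith

/-! ### The number `λ` -/

lemma isRoot_cubic_iff {a b : ℕ} {r : ℝ} : (cubic a b).IsRoot r ↔
    r ^ 3 - ((a : ℝ) + b) / 2 * r ^ 2 + (((b : ℝ) - a) / 2) ^ 2 = 0 := by
  have : (((b : ℝ) - a) / 2) ^ 2 = ((b : ℝ) - a) ^ 2 / 4 := by ring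
  rw [Polynomial.IsRoot.def, this]
  simp [cubic]

lemma aeval_cubic {a b : ℕ} {z : ℂ} : Polynomial.aeval z (cubic a b) =
    z ^ 3 - ((((a : ℝ) + b) / 2 : ℝ) : ℂ) * z ^ 2 + (((((b : ℝ) - a) / 2) ^ 2 : ℝ) : ℂ) := by
  have : (((b : ℝ) - a) / 2) ^ 2 = ((b : ℝ) - a) ^ 2 / 4 := by ring
  rw [this]
  simp only [cubic, map_add, map_sub, map_mul, map_pow, Polynomial.aeval_X, Polynomial.aeval_C,
    Complex.coe_algebraMap]

/-- With `q = s - lam`, where `s = (a+b)/2`, the roots other than `lam` satisfy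
`z² = q z + q lam`; as `2 q < lam`, they have modulus less than `lam`. -/
lemma isDominantRoot_cubic {a b : ℕ} {lam : ℝ} (h0 : 0 < lam)
    (hroot : lam ^ 3 - ((a : ℝ) + b) / 2 * lam ^ 2 + (((b : ℝ) - a) / 2) ^ 2 = 0)
    (hlow : 2 / 3 * (((a : ℝ) + b) / 2) < lam) (hup : lam < ((a : ℝ) + b) / 2) :
    IsDominantRoot (cubic a b) lam := by
  refine ⟨isRoot_cubic_iff.2 hroot, fun z hz hne => ?_⟩
  rw [aeval_cubic] at hz
  obtain ⟨s, hs⟩ : ∃ s : ℝ, s = ((a : ℝ) + b) / 2 := ⟨_, rfl⟩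
  obtain ⟨e, he⟩ : ∃ e : ℝ, e = (((b : ℝ) - a) / 2) ^ 2 := ⟨_, rfl⟩
  rw [← hs, ← he] at hz hroot
  rw [← hs] at hlow hup
  have hroot' : (lam : ℂ) ^ 3 - (s : ℂ) * lam ^ 2 + e = 0 := by exact_mod_cast hroot
  have hfac : (z - lam) * (z ^ 2 - ((s - lam : ℝ) : ℂ) * z - ((s - lam : ℝ) : ℂ) * lam) = 0 := by
    push_cast
    linear_combination hz - hroot'
  have hquad : z ^ 2 = ((s - lam : ℝ) : ℂ) * z + ((s - lam : ℝ) : ℂ) * lam := by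
    have := (mul_eq_zero.1 hfac).resolve_left (sub_ne_zero.2 hne)
    linear_combination this
  have hn : ‖z‖ ^ 2 ≤ (s - lam) * ‖z‖ + (s - lam) * lam := by
    have h1 := norm_add_le (((s - lam : ℝ) : ℂ) * z) (((s - lam : ℝ) : ℂ) * lam)
    rw [← hquad, norm_pow, norm_mul, norm_mul, Complex.norm_real, Complex.norm_real,
      Real.norm_of_nonneg (by linarith), Real.norm_of_nonneg h0.le] at h1
    exact h1
  rw [abs_of_pos h0]
  by_contra! hge
  have h2 : (s - lam) * lam ≤ (s - lam) * ‖z‖ := mul_le_mul_of_nonneg_left hge (by linarith)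
  nlinarith

/-- The cubic is negative at `max d (2s/3)`, where `s = (a+b)/2` and `d = (b-a)/2`, and positive
at `s`. -/
lemma exists_root_cubic {a b : ℕ} (ha3 : 3 ≤ a) (hab : a < b) :
    ∃ lam : ℝ, lam ^ 3 - ((a : ℝ) + b) / 2 * lam ^ 2 + (((b : ℝ) - a) / 2) ^ 2 = 0 ∧
      ((b : ℝ) - a) / 2 < lam ∧ 2 / 3 * (((a : ℝ) + b) / 2) < lam ∧
      lam < ((a : ℝ) + b) / 2 := by
  have ha' : (3 : ℝ) ≤ a := by exact_mod_cast ha3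
  have hb' : (a : ℝ) < b := by exact_mod_cast hab
  obtain ⟨d, hd⟩ : ∃ d : ℝ, d = ((b : ℝ) - a) / 2 := ⟨_, rfl⟩
  obtain ⟨s, hs⟩ : ∃ s : ℝ, s = ((a : ℝ) + b) / 2 := ⟨_, rfl⟩
  have hsd : d + 3 ≤ s := by linarith
  have hd0 : 0 < d := by linarith
  rw [← hd, ← hs]
  -- At `2s/3`, the critical point, the cubic is `d² - 4s³/27`, negative as `s ≥ d + 3`;
  -- at `d` it is `d² (1 - a)`.
  have hneg : ∃ m : ℝ, d ≤ m ∧ 2 / 3 * s ≤ m ∧ m < s ∧ m ^ 3 - s * m ^ 2 + d ^ 2 < 0 := by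
    rcases le_total d (2 / 3 * s) with h | h
    · refine ⟨2 / 3 * s, h, le_rfl, by linarith, ?_⟩
      have h1 : (d + 3) ^ 3 ≤ s ^ 3 := pow_le_pow_left₀ (by linarith) hsd 3
      nlinarith [pow_pos hd0 3]
    · refine ⟨d, le_rfl, h, by linarith, ?_⟩
      nlinarith [pow_pos hd0 2]
  obtain ⟨m, hm1, hm2, hm3, hm4⟩ := hneg
  have hcont : ContinuousOn (fun x : ℝ => x ^ 3 - s * x ^ 2 + d ^ 2) (Set.Icc m s) := by fun_prop
  obtain ⟨x, hx, hx0⟩ := intermediate_value_Ioo hm3.le hcont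
    (show (0 : ℝ) ∈ Set.Ioo _ _ from ⟨hm4, by ring_nf; positivity⟩)
  exact ⟨x, hx0, by linarith [hx.1], by linarith [hx.1], hx.2⟩

lemma IsDominantRoot.unique {P : Polynomial ℝ} {r r' : ℝ} (h : IsDominantRoot P r)
    (h' : IsDominantRoot P r') : r = r' := by
  by_contra hne
  have hz : ∀ {t : ℝ}, P.IsRoot t → Polynomial.aeval (t : ℂ) P = 0 := fun {t} ht => by
    have := Polynomial.aeval_algebraMap_apply ℂ t P
    rw [Complex.coe_algebraMap] at this
    rw [this]
    simpa using ht
  have h1 := h.2 r' (hz h'.1) (by exact_mod_cast Ne.symm hne)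
  have h2 := h'.2 r (hz h.1) (by exact_mod_cast hne)
  rw [Complex.norm_real, Real.norm_eq_abs] at h1 h2
  exact lt_asymm h1 h2

lemma sq_lambda_of_one {b : ℕ} (hb : 1 < b) :
    ((1 + Real.sqrt (2 * (b : ℝ) - 1)) / 2) ^ 2 =
      (1 + Real.sqrt (2 * (b : ℝ) - 1)) / 2 + ((b : ℝ) - 1) / 2 := by
  have : (1 : ℝ) < b := by exact_mod_cast hb
  have h := Real.sq_sqrt (show (0 : ℝ) ≤ 2 * b - 1 by linarith)
  linear_combination h / 4

lemma one_lt_lambda_of_one {b : ℕ} (hb : 1 < b) : 1 < (1 + Real.sqrt (2 * (b : ℝ) - 1)) / 2 := by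
  have : (1 : ℝ) < b := by exact_mod_cast hb
  have h : 1 < Real.sqrt (2 * (b : ℝ) - 1) := by
    rw [Real.lt_sqrt (by norm_num)]; linarith
  linarith

lemma existsUnique_isLambda {a b : ℕ} (hab : a < b) (ha : Odd a) : ∃! lam, IsLambda a b lam := by
  by_cases h : a = 1
  · exact ⟨_, ⟨fun _ => rfl, fun h' => absurd h h'⟩, fun y hy => hy.1 h⟩
  · have ha3 : 3 ≤ a := by obtain ⟨k, rfl⟩ := ha; omega
    obtain ⟨lam, h1, h2, h3, h4⟩ := exists_root_cubic ha3 hab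
    have h0 : 0 < lam := by
      have : (0 : ℝ) ≤ 2 / 3 * (((a : ℝ) + b) / 2) := by positivity
      linarith
    have hdom := isDominantRoot_cubic h0 h1 h3 h4
    exact ⟨lam, ⟨fun h' => absurd h' h, fun _ => hdom⟩, fun y hy => (hy.2 h).unique hdom⟩

/-- The facts about `lam` that the growth estimates use, together with the comparison of `lam`
with the harmonic mean `2ab/(a+b)`. -/
lemma IsLambda.spec {a b : ℕ} (hab : a < b) (ha : Odd a) {lam : ℝ} (h : IsLambda a b lam) :
    1 < lam ∧ 2 * (a : ℝ) * b / ((a : ℝ) + b) ≤ lam ∧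
      (a = 1 ∧ lam ^ 2 = lam + ((b : ℝ) - 1) / 2 ∨
        lam ^ 3 - ((a : ℝ) + b) / 2 * lam ^ 2 + (((b : ℝ) - a) / 2) ^ 2 = 0 ∧
          ((b : ℝ) - a) / 2 < lam) := by
  by_cases h1 : a = 1
  · subst h1
    have hsq := sq_lambda_of_one hab
    have hlt := one_lt_lambda_of_one hab
    rw [← h.1 rfl] at hsq hlt
    refine ⟨hlt, ?_, Or.inl ⟨rfl, hsq⟩⟩
    have hb : (1 : ℝ) < b := by exact_mod_cast hab
    -- The harmonic mean `t` satisfies `t² - t ≤ (b-1)/2 = lam² - lam`.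
    set t : ℝ := 2 * ((1 : ℕ) : ℝ) * b / (((1 : ℕ) : ℝ) + b) with ht
    have ht' : t * (1 + b) = 2 * b := by rw [ht]; push_cast; field_simp
    by_contra! hlt'
    have hb1 : (0 : ℝ) < (1 + b) ^ 2 := by positivity
    have e1 : (t ^ 2 - t) * (1 + b) ^ 2 = 2 * b * (b - 1) := by
      linear_combination (t * (1 + b) + 2 * b - (1 + b)) * ht'
    have e2 : ((b : ℝ) - 1) / 2 * (1 + b) ^ 2 < (t ^ 2 - t) * (1 + b) ^ 2 := by
      apply mul_lt_mul_of_pos_right _ hb1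
      nlinarith
    have e3 : 0 ≤ ((b : ℝ) - 1) * (b - 1) ^ 2 := by
      apply mul_nonneg (by linarith) (by positivity)
    nlinarith
  · have ha3 : 3 ≤ a := by obtain ⟨k, rfl⟩ := ha; omega
    obtain ⟨r, r1, r2, r3, r4⟩ := exists_root_cubic ha3 hab
    have ha' : (3 : ℝ) ≤ a := by exact_mod_cast ha3
    have hb' : (a : ℝ) < b := by exact_mod_cast hab
    obtain rfl : lam = r :=
      (h.2 h1).unique (isDominantRoot_cubic (by linarith) r1 r3 r4)
    refine ⟨by linarith, ?_, Or.inr ⟨r1, r2⟩⟩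
    set t : ℝ := 2 * (a : ℝ) * b / ((a : ℝ) + b) with ht
    obtain ⟨d, hd⟩ : ∃ d : ℝ, d = ((b : ℝ) - a) / 2 := ⟨_, rfl⟩
    obtain ⟨s, hs⟩ : ∃ s : ℝ, s = ((a : ℝ) + b) / 2 := ⟨_, rfl⟩
    rw [← hd, ← hs] at r1
    rw [← hs] at r3 r4
    have hs4 : 3 ≤ s := by linarith
    have hts : t * s = s ^ 2 - d ^ 2 := by
      rw [ht, hs, hd]; field_simp; ring
    by_contra! hlt
    -- Either `t² ≤ s`, and `lam > 2s/3 ≥ √s ≥ t`, or the cubic is nonpositive at `t`.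
    rcases le_total (t ^ 2) s with h2 | h2
    · nlinarith
    · have e1 : (t ^ 3 - s * t ^ 2 + d ^ 2) * s = d ^ 2 * (s - t ^ 2) := by
        linear_combination t ^ 2 * hts
      have e2 : (t ^ 3 - s * t ^ 2 + d ^ 2) * s ≤ 0 := by
        rw [e1]
        exact mul_nonpos_of_nonneg_of_nonpos (sq_nonneg _) (by linarith)
      have e3 : t ^ 3 - s * t ^ 2 + d ^ 2 ≤ 0 := by nlinarith
      have e4 : (t - lam) * (t ^ 2 - (s - lam) * t - (s - lam) * lam) ≤ 0 := by
        have : (t - lam) * (t ^ 2 - (s - lam) * t - (s - lam) * lam) =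
          t ^ 3 - s * t ^ 2 + d ^ 2 := by linear_combination -r1
        rw [this]; exact e3
      have e5 : 0 < t ^ 2 - (s - lam) * t - (s - lam) * lam := by nlinarith
      have := mul_pos (sub_pos.2 hlt) e5
      linarith

lemma log_ratio_lt {a b : ℕ} (ha1 : 1 ≤ a) (hab : a < b) {lam : ℝ}
    (h1 : 1 < lam) (h : 2 * (a : ℝ) * b / ((a : ℝ) + b) ≤ lam) :
    Real.log (2 * lam) / Real.log lam <
      Real.log (2 * (b : ℝ) ^ 2) / Real.log (2 * (a : ℝ) * b / ((a : ℝ) + b)) := by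
  have ha' : (1 : ℝ) ≤ a := by exact_mod_cast ha1
  have hb' : (a : ℝ) < b := by exact_mod_cast hab
  have hab0 : (0 : ℝ) < (a : ℝ) + b := by linarith
  set t : ℝ := 2 * (a : ℝ) * b / ((a : ℝ) + b) with ht
  have ht1 : 1 < t := by
    rw [ht, lt_div_iff₀ hab0]; nlinarith
  have htb : t < b ^ 2 := by
    rw [ht, div_lt_iff₀ hab0]
    nlinarith [mul_pos (show (0 : ℝ) < b by linarith) hab0]
  have hlt : 0 < Real.log t := Real.log_pos ht1
  have hll : 0 < Real.log lam := Real.log_pos h1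
  have hle : Real.log t ≤ Real.log lam := Real.log_le_log (by linarith) h
  rw [Real.log_mul two_ne_zero (by linarith),
    Real.log_mul two_ne_zero (pow_ne_zero 2 (by linarith : (0 : ℝ) < b).ne'), add_div, add_div,
    div_self hll.ne']
  have e1 : Real.log 2 / Real.log lam ≤ Real.log 2 / Real.log t :=
    div_le_div_of_nonneg_left (Real.log_nonneg (by norm_num)) hlt hle
  have e2 : 1 < Real.log ((b : ℝ) ^ 2) / Real.log t := by
    rw [lt_div_iff₀ hlt, one_mul]
    exact Real.log_lt_log (by linarith) htb
  linarith

/-! ### Counting f-smooth words -/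

lemma ncard_le_add_ncard {β : Type*} {X Y : Set β} (hX : X.Finite) (g h : β → β)
    (hY : ∀ y ∈ Y, ∃ x ∈ X, y = g x ∨ y = h x) :
    Y.Finite ∧ Y.ncard ≤ X.ncard + {x ∈ X | g x ∈ Y ∧ h x ∈ Y}.ncard := by
  have hA : {x ∈ X | g x ∈ Y}.Finite := hX.subset (Set.sep_subset _ _)
  have hB : {x ∈ X | h x ∈ Y}.Finite := hX.subset (Set.sep_subset _ _)
  have hsub : Y ⊆ g '' {x ∈ X | g x ∈ Y} ∪ h '' {x ∈ X | h x ∈ Y} := by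
    intro y hy
    obtain ⟨x, hx, rfl | rfl⟩ := hY y hy
    · exact Or.inl ⟨x, ⟨hx, hy⟩, rfl⟩
    · exact Or.inr ⟨x, ⟨hx, hy⟩, rfl⟩
  have hfin := (hA.image g).union (hB.image h)
  refine ⟨hfin.subset hsub, ?_⟩
  have h1 := Set.ncard_le_ncard hsub hfin
  have h2 := Set.ncard_union_le (g '' {x ∈ X | g x ∈ Y}) (h '' {x ∈ X | h x ∈ Y})
  have h3 := Set.ncard_image_le (f := g) hA
  have h4 := Set.ncard_image_le (f := h) hB
  have h5 := Set.ncard_union_add_ncard_inter _ _ hA hB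
  have h6 : ({x ∈ X | g x ∈ Y} ∪ {x ∈ X | h x ∈ Y}).ncard ≤ X.ncard :=
    Set.ncard_le_ncard (Set.union_subset (Set.sep_subset _ _) (Set.sep_subset _ _)) hX
  have h7 : {x ∈ X | g x ∈ Y} ∩ {x ∈ X | h x ∈ Y} = {x ∈ X | g x ∈ Y ∧ h x ∈ Y} := by
    ext x; simp only [Set.mem_inter_iff, Set.mem_ofPred_eq]; tauto
  rw [h7] at h5
  omega

/-- The right special words of length `n`: both one-letter extensions to the right are
f-smooth. -/
def rightSpecial (a b n : ℕ) : Set (List ℕ) :=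
  {u | (u ++ [a] ∈ fSmooth a b ∧ u ++ [b] ∈ fSmooth a b) ∧ u.length = n}

lemma complexity_succ {a b : ℕ} (ha : 1 ≤ a) (hab : a < b) {n : ℕ}
    (hfin : {u ∈ fSmooth a b | u.length = n}.Finite) :
    {u ∈ fSmooth a b | u.length = n + 1}.Finite ∧
      complexity (fSmooth a b) (n + 1) ≤
        complexity (fSmooth a b) n + (rightSpecial a b n).ncard := by
  obtain ⟨h1, h2⟩ := ncard_le_add_ncard (Y := {u ∈ fSmooth a b | u.length = n + 1}) hfin
    (fun u => u ++ [a]) (fun u => u ++ [b]) (by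
      rintro u ⟨hu, hlen⟩
      have hne : u ≠ [] := by rintro rfl; simp at hlen
      refine ⟨u.dropLast, ⟨fSmooth_dropLast ha hab hu, by simp [hlen]⟩, ?_⟩
      have h := List.dropLast_append_getLast hne
      rcases (isDerivable_of_fSmooth hu).1 _ (List.getLast_mem hne) with h' | h' <;>
        rw [h'] at h
      exacts [Or.inl h.symm, Or.inr h.symm])
  refine ⟨h1, h2.trans (Nat.add_le_add_left (Set.ncard_le_ncard ?_ ?_) _)⟩
  · rintro u ⟨⟨-, hlen⟩, ⟨h3, -⟩, ⟨h4, -⟩⟩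
    exact ⟨⟨h3, h4⟩, hlen⟩
  · refine hfin.subset ?_
    rintro u ⟨⟨h3, -⟩, hlen⟩
    exact ⟨by simpa using fSmooth_dropLast ha hab h3, hlen⟩

lemma finite_fSmooth_length {a b : ℕ} (ha : 1 ≤ a) (hab : a < b) (n : ℕ) :
    {u ∈ fSmooth a b | u.length = n}.Finite := by
  induction n with
  | zero => exact (Set.finite_singleton []).subset fun u hu => List.length_eq_zero_iff.1 hu.2
  | succ n ih => exact (complexity_succ ha hab ih).1

lemma finite_rightSpecial {a b : ℕ} (ha : 1 ≤ a) (hab : a < b) (n : ℕ) :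
    (rightSpecial a b n).Finite := by
  refine (finite_fSmooth_length ha hab n).subset ?_
  rintro u ⟨⟨h3, -⟩, hlen⟩
  exact ⟨by simpa using fSmooth_dropLast ha hab h3, hlen⟩

lemma ncard_rightSpecial_succ {a b : ℕ} (ha : 1 ≤ a) (hab : a < b) (n : ℕ) :
    (rightSpecial a b (n + 1)).ncard ≤
      (rightSpecial a b n).ncard + {u ∈ bispecial a b | u.length = n}.ncard := by
  obtain ⟨-, h2⟩ := ncard_le_add_ncard (Y := rightSpecial a b (n + 1))
    (finite_rightSpecial ha hab n) (fun u => a :: u) (fun u => b :: u) (by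
      rintro u ⟨⟨hu, hu'⟩, hlen⟩
      rcases u with _ | ⟨c, u⟩
      · simp at hlen
      refine ⟨u, ⟨⟨fSmooth_tail ha hab hu, fSmooth_tail ha hab hu'⟩, by simpa using hlen⟩, ?_⟩
      rcases (isDerivable_of_fSmooth hu).1 c (by simp) with rfl | rfl <;> simp)
  refine h2.trans (Nat.add_le_add_left (Set.ncard_le_ncard ?_ ?_) _)
  · rintro u ⟨⟨-, hlen⟩, ⟨⟨h3, h4⟩, -⟩, ⟨⟨h5, h6⟩, -⟩⟩
    refine ⟨?_, hlen⟩
    rintro x y (rfl | rfl) (rfl | rfl) <;> assumption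
  · refine (finite_rightSpecial ha hab n).subset ?_
    rintro u ⟨hu, hlen⟩
    exact ⟨⟨fSmooth_tail ha hab (hu a a (by simp) (by simp)),
      fSmooth_tail ha hab (hu a b (by simp) (by simp))⟩, hlen⟩

lemma sum_ncard_bispecial_le {a b : ℕ} (ha : 1 ≤ a) (hab : a < b) {n N : ℕ}
    (h : ∀ k, ∀ u ∈ level a b k, u.length < n → k < N) :
    ∑ m ∈ Finset.range n, {u ∈ bispecial a b | u.length = m}.ncard ≤ 1 + 4 * 2 ^ N := by
  let F : Finset (List ℕ) := insert [] ((Finset.range N).biUnion (level a b))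
  have hF : F.card ≤ 1 + 4 * 2 ^ N := by
    have h1 := Finset.card_insert_le ([] : List ℕ) ((Finset.range N).biUnion (level a b))
    have h2 := Finset.card_biUnion_le (s := Finset.range N) (t := level a b)
    have h3 : ∑ k ∈ Finset.range N, (level a b k).card ≤ ∑ k ∈ Finset.range N, 4 * 2 ^ k :=
      Finset.sum_le_sum fun k _ => card_level_le a b k
    rw [← Finset.mul_sum] at h3
    have h4 := Nat.geomSum_lt (m := 2) (n := N) (s := Finset.range N) le_rfl
      fun k hk => Finset.mem_range.1 hk
    change (insert [] ((Finset.range N).biUnion (level a b))).card ≤ _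
    omega
  have hsub : ∀ m ∈ Finset.range n, {u ∈ bispecial a b | u.length = m}.ncard ≤
      (F.filter fun u => u.length = m).card := by
    intro m hm
    rw [← Set.ncard_coe_finset]
    refine Set.ncard_le_ncard ?_ (Finset.finite_toSet _)
    rintro u ⟨hu, hlen⟩
    rw [Finset.mem_coe, Finset.mem_filter]
    refine ⟨?_, hlen⟩
    rcases bispecial_mem_level ha hab hu with rfl | ⟨k, hk⟩
    · exact Finset.mem_insert_self _ _
    · refine Finset.mem_insert_of_mem (Finset.mem_biUnion.2 ⟨k, ?_, hk⟩)
      exact Finset.mem_range.2 (h k u hk (by rw [hlen]; exact Finset.mem_range.1 hm))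
  refine (Finset.sum_le_sum hsub).trans (le_trans ?_ hF)
  rw [Finset.sum_card_fiberwise_eq_card_filter]
  exact Finset.card_filter_le _ _

lemma le_add_sum_range {f g : ℕ → ℕ} (h : ∀ n, f (n + 1) ≤ f n + g n) (n : ℕ) :
    f n ≤ f 0 + ∑ m ∈ Finset.range n, g m := by
  induction n with
  | zero => simp
  | succ n ih =>
    rw [Finset.sum_range_succ]
    have := h n
    omega

lemma ncard_length_zero_le (L : Set (List ℕ)) : {u ∈ L | u.length = 0}.ncard ≤ 1 := by
  rw [← Set.ncard_singleton ([] : List ℕ)]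
  exact Set.ncard_le_ncard (fun u hu => List.length_eq_zero_iff.1 hu.2) (Set.finite_singleton _)

/-- The second differences of the complexity are bounded by the number of bispecial words, so
summing twice bounds the complexity. -/
lemma complexity_le {a b : ℕ} (ha : 1 ≤ a) (hab : a < b) {n N : ℕ}
    (h : ∀ k, ∀ u ∈ level a b k, u.length < n → k < N) :
    complexity (fSmooth a b) n ≤ 1 + n * (2 + 4 * 2 ^ N) := by
  have h1 := le_add_sum_range (f := complexity (fSmooth a b)) (fun n => (complexity_succ ha hab
    (finite_fSmooth_length ha hab n)).2) n
  have h2 : ∀ m ∈ Finset.range n, (rightSpecial a b m).ncard ≤ 2 + 4 * 2 ^ N := by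
    intro m hm
    have h3 := le_add_sum_range (f := fun n => (rightSpecial a b n).ncard)
      (ncard_rightSpecial_succ ha hab) m
    have h4 : (rightSpecial a b 0).ncard ≤ 1 := ncard_length_zero_le _
    have h5 := sum_ncard_bispecial_le (n := m) ha hab fun k u hu hlt =>
      h k u hu (hlt.trans (Finset.mem_range.1 hm))
    omega
  have h6 := Finset.sum_le_card_nsmul _ _ _ h2
  rw [Finset.card_range, smul_eq_mul] at h6
  have h7 : complexity (fSmooth a b) 0 ≤ 1 := ncard_length_zero_le _
  omega

lemma complexity_isBigO {a b : ℕ} (ha : 1 ≤ a) (hab : a < b) {lam c : ℝ} (h1 : 1 < lam)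
    (hc : 0 < c) (hlev : ∀ k, ∀ u ∈ level a b k, c * lam ^ k ≤ u.length) :
    Asymptotics.IsBigO Filter.atTop
      (fun n : ℕ => (complexity (fSmooth a b) n : ℝ))
      (fun n : ℕ => (n : ℝ) ^ (Real.log (2 * lam) / Real.log lam)) := by
  have hll : 0 < Real.log lam := Real.log_pos h1
  have hexp : Real.log (2 * lam) / Real.log lam = 1 + Real.log 2 / Real.log lam := by
    rw [Real.log_mul two_ne_zero (by linarith), add_div, div_self hll.ne', add_comm]
  rw [hexp]
  set θ := Real.log 2 / Real.log lam with hθ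
  obtain ⟨n₀, hn₀⟩ := exists_nat_ge c
  refine Asymptotics.IsBigO.of_bound (14 * (c ^ θ)⁻¹) ?_
  filter_upwards [Filter.eventually_ge_atTop (max n₀ 1)] with n hn
  have hn1 : 1 ≤ n := (le_max_right _ _).trans hn
  have hn1' : (1 : ℝ) ≤ n := by exact_mod_cast hn1
  have hnc : c ≤ n := hn₀.trans (by exact_mod_cast (le_max_left _ _).trans hn)
  -- From level `N` on, all words have length at least `n`.
  set x := Real.log (n / c) / Real.log lam with hx
  set N := ⌈x⌉₊ with hN
  have hx0 : 0 ≤ x := div_nonneg (Real.log_nonneg (by rwa [one_le_div hc])) hll.le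
  have hnlam : (n : ℝ) ≤ c * lam ^ N := by
    rw [mul_comm, ← div_le_iff₀ hc, ← Real.log_le_log_iff (by positivity)
      (pow_pos (by linarith) N), Real.log_pow, ← div_le_iff₀ hll]
    exact Nat.le_ceil x
  have hbound := complexity_le ha hab (n := n) (N := N) fun k u hu hlt => by
    have h2 := hlev k u hu
    have h3 : (u.length : ℝ) < n := by exact_mod_cast hlt
    have h4 : lam ^ k < lam ^ N := by
      refine lt_of_mul_lt_mul_left ?_ hc.le
      linarith
    exact (pow_lt_pow_iff_right₀ h1).1 h4
  have hbound' : (complexity (fSmooth a b) n : ℝ) ≤ 1 + n * (2 + 4 * 2 ^ N) := by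
    exact_mod_cast hbound
  have hpow : (2 : ℝ) ^ N ≤ 2 * ((n : ℝ) ^ θ * (c ^ θ)⁻¹) := by
    have e1 : (2 : ℝ) ^ N ≤ 2 ^ (x + 1) := by
      rw [← Real.rpow_natCast]
      exact Real.rpow_le_rpow_of_exponent_le one_le_two (Nat.ceil_lt_add_one hx0).le
    have e2 : (2 : ℝ) ^ x = (n / c) ^ θ := by
      rw [Real.rpow_def_of_pos two_pos, Real.rpow_def_of_pos (by positivity), hx, hθ]
      congr 1
      ring
    rw [Real.rpow_add two_pos, Real.rpow_one, e2, Real.div_rpow (by positivity) hc.le] at e1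
    rw [← div_eq_mul_inv, mul_comm]
    exact e1
  rw [Real.norm_of_nonneg (by positivity), Real.norm_of_nonneg (by positivity),
    Real.rpow_add (by linarith), Real.rpow_one]
  have hN1 : (1 : ℝ) ≤ 2 ^ N := one_le_pow₀ one_le_two
  calc (complexity (fSmooth a b) n : ℝ) ≤ 1 + n * (2 + 4 * 2 ^ N) := hbound'
    _ ≤ 7 * (n * 2 ^ N) := by nlinarith
    _ ≤ 7 * (n * (2 * ((n : ℝ) ^ θ * (c ^ θ)⁻¹))) := by gcongr
    _ = 14 * (c ^ θ)⁻¹ * (n * (n : ℝ) ^ θ) := by ring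

end FSmooth

theorem theorem3 (a b : ℕ) (ha1 : 1 ≤ a) (hab : a < b) (ha : Odd a) (hb : Odd b) :
    (∃! lam : ℝ, FSmooth.IsLambda a b lam) ∧
    ∀ lam : ℝ, FSmooth.IsLambda a b lam →
      1 < lam ∧
      Asymptotics.IsBigO Filter.atTop
        (fun n : ℕ => (FSmooth.complexity (FSmooth.fSmooth a b) n : ℝ))
        (fun n : ℕ => (n : ℝ) ^ (Real.log (2 * lam) / Real.log lam)) ∧
      Real.log (2 * lam) / Real.log lam <
        Real.log (2 * (b : ℝ) ^ 2) / Real.log (2 * (a : ℝ) * b / ((a : ℝ) + b)) := by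
  refine ⟨FSmooth.existsUnique_isLambda hab ha, fun lam hlam => ?_⟩
  obtain ⟨h1, hmean, hroot⟩ := hlam.spec hab ha
  refine ⟨h1, ?_, FSmooth.log_ratio_lt ha1 hab h1 hmean⟩
  obtain ⟨c, hc, hlev⟩ : ∃ c : ℝ, 0 < c ∧
      ∀ k, ∀ u ∈ FSmooth.level a b k, c * lam ^ k ≤ u.length := by
    rcases hroot with ⟨rfl, h⟩ | ⟨h, hd⟩
    · exact ⟨lam⁻¹, by positivity,
        fun k u hu => FSmooth.length_lower_bound_of_one hab hb h1 h k hu⟩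
    · exact FSmooth.length_lower_bound_of_cubic hab ha hb h1 hd h
  exact FSmooth.complexity_isBigO ha1 hab h1 hc hlev
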